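/- \textbf{Setting (blocked collaborative bandits with one cluster).} There are $M\ge 1$ users, $N$ items and $T\ge 1$ rounds, and an integer blocking constraint $B\ge 1$ that divides $T$. A reward matrix $P\in[0,1]^{M\times N}$ is unknown to the algorithm; all users form a single cluster ($C=1$), i.e. all rows of $P$ are equal. In each round $t\in[T]$ the algorithm recommends simultaneously to every user $u\in[M]$ an item $\rho_u(t)\in[N]$, chosen (possibly at random) as a function of everything observed in the earlier rounds for all users, and then observes the rewards $R_u^{(t)}=P_{u\rho_u(t)}+E_u^{(t)}$, where the noise variables $E_u^{(t)}$ are i.i.d. $\mathcal N(0,1)$. The algorithm must (almost surely) not recommend any item more than $B$ times to the same user. If $\pi_u$ is a permutation of $[N]$ that sorts the rewards of user $u$ in descending order, the regret is $$\mathrm{Reg}(T)=\frac1M\sum_{u\in[M]}\sum_{s\in[T/B]}B\,P_{u\pi_u(s)}-\mathbb E\,\frac1M\sum_{t\in[T]}\sum_{u\in[M]}P_{u\rho_u(t)} .$$ \textbf{Theorem 2.} For every $\varepsilon>0$ there is a constant $c=c(\varepsilon)>0$ such that the following holds for all $M,N,T,B$ as above with $N\ge(1+\varepsilon)\,T/B$.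 For every algorithm that respects the blocking constraint there is a reward matrix $P\in[0,1]^{M\times N}$ with all rows equal on which $$\mathrm{Reg}(T)\ \ge\ c\,\min\Big\{T,\ \max\Big(\sqrt{\frac{NB}{M}},\ \frac{T\sqrt{\log^+(N/T)}}{B\sqrt M}\Big)\Big\},\qquad \log^+x=\max(0,\log x).$$ In particular, whenever $\max\big(\sqrt{NB/M},\,T\sqrt{\log^+(N/T)}/(B\sqrt M)\big)\le T$, the regret is at least $c$ times this maximum. -/

import Mathlib

open MeasureTheory ProbabilityTheory
open scoped ENNReal

namespace BlockedBandits

noncomputable section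

/-- What is observed in one round: the item recommended to each of the `M` users, and the reward
received from each of them. -/
abbrev Round (M N : ℕ) : Type := (Fin M → Fin N) × (Fin M → ℝ)

/-- The history of the first `t` rounds (numbered `0, …, t - 1`). -/
abbrev History (M N t : ℕ) : Type := Fin t → Round M N

/-- A (possibly randomized) algorithm: at each round `t` it draws the items for all `M` users
jointly, from a distribution depending measurably on everything observed in the earlier rounds. -/
structure Policy (M N : ℕ) where
  /-- The conditional law of the items of round `t` given the history before round `t`. -/
  choose : (t : ℕ) → Kernel (History M N t) (Fin M → Fin N)
  /-- It is a probability law. -/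
  markov : ∀ t, IsMarkovKernel (choose t)

/-- The rewards of one round given the recommended items `a`: independent over the users, user `u`
giving `P u (a u)` plus standard Gaussian noise. -/
def feedback {M N : ℕ} (P : Fin M → Fin N → ℝ) : Kernel (Fin M → Fin N) (Fin M → ℝ) :=
  Kernel.ofFunOfCountable fun a => Measure.pi fun u => gaussianReal (P u (a u)) 1

/-- The conditional law of round `t` (items and rewards) given the history. -/
def roundKernel {M N : ℕ} (π : Policy M N) (P : Fin M → Fin N → ℝ) (t : ℕ) :
    Kernel (History M N t) (Round M N) :=
  (π.choose t) ⊗ₖ Kernel.prodMkLeft (History M N t) (feedback P)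

/-- The law of the history of the first `t` rounds when policy `π` faces reward matrix `P`. -/
def historyLaw {M N : ℕ} (π : Policy M N) (P : Fin M → Fin N → ℝ) :
    (t : ℕ) → Measure (History M N t)
  | 0 => Measure.dirac Fin.elim0
  | t + 1 => ((historyLaw π P t) ⊗ₘ (roundKernel π P t)).map
      fun x => (Fin.snoc x.1 x.2 : History M N (t + 1))

/-- The policy respects the blocking constraint over `T` rounds: almost surely, whatever the reward
matrix, no item is recommended more than `B` times to the same user. -/
def Policy.RespectsBlocking {M N : ℕ} (π : Policy M N) (T B : ℕ) : Prop :=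
  ∀ P : Fin M → Fin N → ℝ, ∀ᵐ h ∂(historyLaw π P T), ∀ (u : Fin M) (i : Fin N),
    (Finset.univ.filter fun t : Fin T => (h t).1 u = i).card ≤ B

/-- The users can be partitioned into `C` (nonempty) clusters such that users in the same cluster
have identical reward vectors. -/
def HasClusters {M N : ℕ} (P : Fin M → Fin N → ℝ) (C : ℕ) : Prop :=
  ∃ f : Fin M → Fin C, Function.Surjective f ∧ ∀ u v, f u = f v → P u = P v

/-- The permutation listing the items in order of decreasing reward. -/
def sortDesc {N : ℕ} (p : Fin N → ℝ) : Equiv.Perm (Fin N) := Tuple.sort fun i => -p i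

/-- The regret of `π` on the reward matrix `P` over `T` rounds with blocking constraint `B`, averaged
over the users: the reward of recommending `B` times each of the best `T / B` items, minus the
expected sum of the mean rewards of the recommended items. -/
def regret {M N : ℕ} (π : Policy M N) (P : Fin M → Fin N → ℝ) (T B : ℕ) : ℝ :=
  (∑ u : Fin M, ∑ s : Fin N with s.val < T / B, (B : ℝ) * P u (sortDesc (P u) s) / M)
    - ∫ h, (∑ t : Fin T, ∑ u : Fin M, P u ((h t).1 u) / M) ∂(historyLaw π P T)

end

end BlockedBandits

namespace BlockedBandits

noncomputable section

variable {M N : ℕ} {Q P : Fin M → Fin N → ℝ} {i : Fin N} {Δ : ℝ}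

/-! The bound proved is stronger: regret of order `min T √(NT/M)`, which dominates both terms of the
maximum. Put `S = T/B` and let a set `G` of items have mean `Δ` and all others mean `0`. Suppose
every `G` gives regret below `ρΔT`. For `|G| = S`, nearly all of the `MT` pulls must fall in `G`.
For `|G| = S - 1`, the items outside `G` together receive at most `MB + ρMT` pulls, hence few each
on average, since there are `N - S + 1` of them. Now pass from `G` to `insert i G` with `i` outside
`G`: the KL divergence of the histories is `Δ²/2` times the expected pulls of `i`, and blocking caps
those pulls at `MB`, so for small `Δ` they cannot grow enough (`IsShift.integral_pulls_le`). Double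
counting the pairs `(G, i)` (`le_of_forall_insert_le`) gives a contradiction when `Δ²MT` is at most
a small multiple of `N - S + 1`; this is `exists_goodItems_regret_ge`. The assumption `N ≥ (1+ε)S`
makes `N - S + 1` comparable to `N`. -/

/-! ### Kernels and iterated integrals over histories. -/

instance Policy.isMarkovKernel_choose {M N : ℕ} (π : Policy M N) (t : ℕ) :
    IsMarkovKernel (π.choose t) := π.markov t

instance isMarkovKernel_feedback {M N : ℕ} (P : Fin M → Fin N → ℝ) :
    IsMarkovKernel (feedback P) :=
  ⟨fun a => by
    change IsProbabilityMeasure (Measure.pi fun u => gaussianReal (P u (a u)) 1)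
    infer_instance⟩

instance isMarkovKernel_roundKernel {M N : ℕ} (π : Policy M N) (P : Fin M → Fin N → ℝ) (t : ℕ) :
    IsMarkovKernel (roundKernel π P t) := by
  unfold roundKernel; infer_instance

lemma measurable_snoc {M N t : ℕ} :
    Measurable fun x : History M N t × Round M N => (Fin.snoc x.1 x.2 : History M N (t + 1)) := by
  refine measurable_pi_iff.2 fun s => ?_
  refine Fin.lastCases ?_ (fun s => ?_) s
  · simpa using measurable_snd
  · simp only [Fin.snoc_castSucc]
    exact (measurable_pi_apply s).comp measurable_fst

instance isProbabilityMeasure_historyLaw {M N : ℕ} (π : Policy M N) (P : Fin M → Fin N → ℝ)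
    (t : ℕ) : IsProbabilityMeasure (historyLaw π P t) := by
  induction t with
  | zero => unfold historyLaw; infer_instance
  | succ t ih =>
    unfold historyLaw
    exact Measure.isProbabilityMeasure_map measurable_snoc.aemeasurable

lemma lintegral_historyLaw_succ (π : Policy M N) (P : Fin M → Fin N → ℝ) (t : ℕ)
    {f : History M N (t + 1) → ℝ≥0∞} (hf : Measurable f) :
    ∫⁻ h, f h ∂historyLaw π P (t + 1) =
      ∫⁻ h, ∫⁻ r, f (Fin.snoc h r : History M N (t + 1)) ∂roundKernel π P t h
        ∂historyLaw π P t := by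
  rw [historyLaw, lintegral_map hf measurable_snoc,
    Measure.lintegral_compProd (f := fun x => f (Fin.snoc x.1 x.2 : History M N (t + 1)))
      (hf.comp measurable_snoc)]

lemma lintegral_roundKernel (π : Policy M N) (P : Fin M → Fin N → ℝ) (t : ℕ)
    (h : History M N t) {f : Round M N → ℝ≥0∞} (hf : Measurable f) :
    ∫⁻ r, f r ∂roundKernel π P t h =
      ∫⁻ a, ∫⁻ x, f (a, x) ∂feedback P a ∂π.choose t h := by
  rw [roundKernel, Kernel.lintegral_compProd _ _ _ hf]
  rfl

/-! ### Likelihood ratios and change of measure. -/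

/-- The log-likelihood ratio of one round when the mean reward of item `i` moves from `0` to `Δ`. -/
def score (i : Fin N) (Δ : ℝ) (r : Round M N) : ℝ :=
  ∑ u, if r.1 u = i then Δ * r.2 u - Δ ^ 2 / 2 else 0

/-- The log-likelihood ratio of a history when the mean reward of item `i` moves from `0` to `Δ`. -/
def logLikelihood (i : Fin N) (Δ : ℝ) {t : ℕ} (h : History M N t) : ℝ := ∑ s, score i Δ (h s)

/-- The number of times item `i` is recommended in one round. -/
def roundPulls (i : Fin N) (r : Round M N) : ℝ := ∑ u, if r.1 u = i then 1 else 0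

/-- The number of times item `i` is recommended along a history. -/
def pulls (i : Fin N) {t : ℕ} (h : History M N t) : ℝ := ∑ s, roundPulls i (h s)

lemma measurableSet_recommends (i : Fin N) (u : Fin M) :
    MeasurableSet {r : Round M N | r.1 u = i} :=
  measurableSet_eq_fun ((measurable_pi_apply u).comp measurable_fst) measurable_const

lemma measurable_score (i : Fin N) (Δ : ℝ) : Measurable (score (M := M) i Δ) :=
  Finset.measurable_fun_sum _ fun u _ =>
    Measurable.ite (measurableSet_recommends i u) (by fun_prop) measurable_const

lemma measurable_roundPulls (i : Fin N) : Measurable (roundPulls (M := M) i) :=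
  Finset.measurable_fun_sum _ fun u _ =>
    Measurable.ite (measurableSet_recommends i u) measurable_const measurable_const

lemma measurable_logLikelihood (i : Fin N) (Δ : ℝ) (t : ℕ) :
    Measurable (logLikelihood (M := M) i Δ (t := t)) :=
  Finset.measurable_fun_sum _ fun s _ => (measurable_score i Δ).comp (measurable_pi_apply s)

lemma measurable_pulls (i : Fin N) (t : ℕ) : Measurable (pulls (M := M) i (t := t)) :=
  Finset.measurable_fun_sum _ fun s _ => (measurable_roundPulls i).comp (measurable_pi_apply s)

lemma gaussianReal_eq_withDensity (Δ : ℝ) :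
    gaussianReal Δ 1 =
      (gaussianReal 0 1).withDensity fun x => ENNReal.ofReal (Real.exp (Δ * x - Δ ^ 2 / 2)) := by
  rw [gaussianReal_of_var_ne_zero _ one_ne_zero, gaussianReal_of_var_ne_zero _ one_ne_zero,
    ← withDensity_mul _ (measurable_gaussianPDF _ _) (by fun_prop)]
  congr 1
  ext x
  rw [Pi.mul_apply, gaussianPDF, gaussianPDF, ← ENNReal.ofReal_mul (gaussianPDFReal_nonneg _ _ _)]
  congr 1
  simp only [gaussianPDFReal]
  rw [mul_assoc _ (Real.exp _) (Real.exp _), ← Real.exp_add]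
  congr 2
  simp only [NNReal.coe_one]
  ring

lemma lintegral_pi_prod {ι : Type*} [Fintype ι] {X : ι → Type*} [∀ j, MeasurableSpace (X j)]
    (μ : ∀ j, Measure (X j)) [∀ j, IsProbabilityMeasure (μ j)] {f : ∀ j, X j → ℝ≥0∞}
    (hf : ∀ j, Measurable (f j)) :
    ∫⁻ x, ∏ j, f j (x j) ∂Measure.pi μ = ∏ j, ∫⁻ x, f j x ∂μ j := by
  have hind : iIndepFun (fun j (x : ∀ j, X j) => f j (x j)) (Measure.pi μ) :=
    iIndepFun_pi fun j => (hf j).aemeasurable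
  have := lintegral_prod_eq_prod_lintegral_of_indepFun Finset.univ _ hind
    fun j => (hf j).comp (measurable_pi_apply j)
  rw [this]
  exact Finset.prod_congr rfl fun j _ =>
    (measurePreserving_eval μ j).lintegral_comp (hf j)

lemma pi_withDensity {ι : Type*} [Fintype ι] {X : ι → Type*} [∀ j, MeasurableSpace (X j)]
    (μ : ∀ j, Measure (X j)) [∀ j, IsProbabilityMeasure (μ j)] {f : ∀ j, X j → ℝ≥0∞}
    (hf : ∀ j, Measurable (f j)) [∀ j, SigmaFinite ((μ j).withDensity (f j))] :
    Measure.pi (fun j => (μ j).withDensity (f j)) =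
      (Measure.pi μ).withDensity fun x => ∏ j, f j (x j) := by
  refine Measure.pi_eq fun s hs => ?_
  rw [withDensity_apply _ (MeasurableSet.univ_pi hs),
    ← lintegral_indicator (MeasurableSet.univ_pi hs)]
  have h : ((Set.univ.pi s).indicator fun x => ∏ j, f j (x j)) =
      fun x => ∏ j, (s j).indicator (f j) (x j) := by
    classical
    ext x
    by_cases hx : x ∈ Set.univ.pi s
    · rw [Set.indicator_of_mem hx]
      exact Finset.prod_congr rfl fun j _ =>
        (Set.indicator_of_mem (hx j (Set.mem_univ j)) _).symm
    · rw [Set.indicator_of_notMem hx]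
      simp only [Set.mem_pi, Set.mem_univ, true_implies, not_forall] at hx
      obtain ⟨j, hj⟩ := hx
      exact (Finset.prod_eq_zero (Finset.mem_univ j) (Set.indicator_of_notMem hj _)).symm
  rw [h, lintegral_pi_prod μ fun j => (hf j).indicator (hs j)]
  exact Finset.prod_congr rfl fun j _ => by
    rw [lintegral_indicator (hs j), withDensity_apply _ (hs j)]

/-- `P` is obtained from `Q` by moving the mean reward of item `i` from `0` to `Δ`. -/
structure IsShift (Q P : Fin M → Fin N → ℝ) (i : Fin N) (Δ : ℝ) : Prop where
  base : ∀ u, Q u i = 0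
  shifted : ∀ u, P u i = Δ
  agree : ∀ u j, j ≠ i → P u j = Q u j

lemma IsShift.feedback_eq (hS : IsShift Q P i Δ) (a : Fin M → Fin N) :
    feedback P a = (feedback Q a).withDensity fun x =>
      ENNReal.ofReal (Real.exp (score i Δ (a, x))) := by
  change Measure.pi (fun u => gaussianReal (P u (a u)) 1) =
    (Measure.pi fun u => gaussianReal (Q u (a u)) 1).withDensity _
  let f : Fin M → ℝ → ℝ≥0∞ := fun u x =>
    ENNReal.ofReal (Real.exp (if a u = i then Δ * x - Δ ^ 2 / 2 else 0))
  have hf : ∀ u, Measurable (f u) := fun u => by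
    by_cases h : a u = i <;> simp only [f, h, if_true, if_false] <;> fun_prop
  have hg : ∀ u, gaussianReal (P u (a u)) 1 = (gaussianReal (Q u (a u)) 1).withDensity (f u) := by
    intro u
    by_cases h : a u = i
    · simp only [f, h, if_true, hS.base, hS.shifted]
      exact gaussianReal_eq_withDensity Δ
    · simp only [f, h, if_false, hS.agree u _ h, Real.exp_zero, ENNReal.ofReal_one]
      exact withDensity_one.symm
  have : ∀ u, SigmaFinite ((gaussianReal (Q u (a u)) 1).withDensity (f u)) := fun u => by
    rw [← hg u]; infer_instance
  simp_rw [hg]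
  rw [pi_withDensity _ hf]
  congr 1
  ext x
  simp only [f, score]
  rw [Real.exp_sum, ENNReal.ofReal_prod_of_nonneg fun _ _ => (Real.exp_pos _).le]

/-- The items are drawn from the same kernel under `P` and `Q`, so only the Gaussian densities of
the rewards contribute. -/
lemma IsShift.lintegral_roundKernel (hS : IsShift Q P i Δ) (π : Policy M N) (t : ℕ)
    (h : History M N t) {f : Round M N → ℝ≥0∞} (hf : Measurable f) :
    ∫⁻ r, f r ∂roundKernel π P t h =
      ∫⁻ r, f r * ENNReal.ofReal (Real.exp (score i Δ r)) ∂roundKernel π Q t h := by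
  have hm : Measurable fun r : Round M N => ENNReal.ofReal (Real.exp (score i Δ r)) :=
    (measurable_score i Δ).exp.ennreal_ofReal
  rw [BlockedBandits.lintegral_roundKernel π P t h hf,
    BlockedBandits.lintegral_roundKernel π Q t h (hf.fun_mul hm)]
  refine lintegral_congr fun a => ?_
  have hma : Measurable fun x => ENNReal.ofReal (Real.exp (score i Δ (a, x))) :=
    hm.comp measurable_prodMk_left
  have hfa : Measurable fun x => f (a, x) := hf.comp measurable_prodMk_left
  rw [hS.feedback_eq, lintegral_withDensity_eq_lintegral_mul _ hma hfa]
  exact lintegral_congr fun x => mul_comm _ _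

/-- Change of measure: the law of the history under `P` has density `exp logLikelihood` with
respect to its law under `Q`. -/
lemma IsShift.lintegral_historyLaw (hS : IsShift Q P i Δ) (π : Policy M N) (t : ℕ)
    {f : History M N t → ℝ≥0∞} (hf : Measurable f) :
    ∫⁻ h, f h ∂historyLaw π P t =
      ∫⁻ h, f h * ENNReal.ofReal (Real.exp (logLikelihood i Δ h)) ∂historyLaw π Q t := by
  induction t with
  | zero =>
    simp only [historyLaw]
    refine lintegral_congr fun h => ?_
    simp [logLikelihood]
  | succ t ih =>
    have hm : ∀ t, Measurable fun h : History M N t =>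
        ENNReal.ofReal (Real.exp (logLikelihood i Δ h)) :=
      fun t => (measurable_logLikelihood i Δ t).exp.ennreal_ofReal
    have hms : Measurable fun r : Round M N => ENNReal.ofReal (Real.exp (score i Δ r)) :=
      (measurable_score i Δ).exp.ennreal_ofReal
    rw [lintegral_historyLaw_succ π P t hf, lintegral_historyLaw_succ π Q t (hf.fun_mul (hm _)),
      ih (Measurable.lintegral_kernel_prod_right
        (f := fun h r => f (Fin.snoc h r : History M N (t + 1))) (hf.comp measurable_snoc))]
    refine lintegral_congr fun h => ?_
    have hfs : Measurable fun r => f (Fin.snoc h r : History M N (t + 1)) :=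
      (hf.comp measurable_snoc).comp measurable_prodMk_left
    rw [hS.lintegral_roundKernel π t h hfs, ← lintegral_mul_const _ (hfs.fun_mul hms)]
    refine lintegral_congr fun r => ?_
    rw [mul_assoc, ← ENNReal.ofReal_mul (Real.exp_pos _).le, ← Real.exp_add]
    congr 3
    simp only [logLikelihood, Fin.sum_univ_castSucc, Fin.snoc_castSucc, Fin.snoc_last]
    rw [add_comm]

/-! ### The reward from an item of mean zero, needed for the expected log-likelihood. -/

/-- The sum of the rewards received from item `i` in one round. -/
def roundReward (i : Fin N) (r : Round M N) : ℝ := ∑ u, if r.1 u = i then r.2 u else 0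

/-- The sum of the rewards received from item `i` along a history. -/
def itemReward (i : Fin N) {t : ℕ} (h : History M N t) : ℝ := ∑ s, roundReward i (h s)

lemma measurable_roundReward (i : Fin N) : Measurable (roundReward (M := M) i) :=
  Finset.measurable_fun_sum _ fun u _ =>
    Measurable.ite (measurableSet_recommends i u) (by fun_prop) measurable_const

lemma logLikelihood_eq (i : Fin N) (Δ : ℝ) {t : ℕ} (h : History M N t) :
    logLikelihood i Δ h = Δ * itemReward i h - Δ ^ 2 / 2 * pulls i h := by
  simp only [logLikelihood, score, itemReward, roundReward, pulls, roundPulls, Finset.mul_sum,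
    ← Finset.sum_sub_distrib]
  refine Finset.sum_congr rfl fun s _ => Finset.sum_congr rfl fun u _ => ?_
  split_ifs <;> ring

lemma feedback_apply (P : Fin M → Fin N → ℝ) (a : Fin M → Fin N) :
    feedback P a = Measure.pi fun u => gaussianReal (P u (a u)) 1 := rfl

lemma integrable_feedback_eval (P : Fin M → Fin N → ℝ) (a : Fin M → Fin N) (u : Fin M) :
    Integrable (fun x => x u) (feedback P a) := by
  rw [feedback_apply]
  exact (measurePreserving_eval (fun u => gaussianReal (P u (a u)) 1) u).integrable_comp_of_integrable
    ((memLp_id_gaussianReal 1).integrable le_rfl)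

lemma integral_feedback_eval (P : Fin M → Fin N → ℝ) (a : Fin M → Fin N) (u : Fin M) :
    ∫ x, x u ∂feedback P a = P u (a u) := by
  rw [feedback_apply]
  have h := measurePreserving_eval (fun u => gaussianReal (P u (a u)) 1) u
  rw [← integral_id_gaussianReal (μ := P u (a u)) (v := 1), ← h.map_eq,
    integral_map h.measurable.aemeasurable (by fun_prop)]

lemma integrable_roundReward_feedback (i : Fin N) (P : Fin M → Fin N → ℝ) (a : Fin M → Fin N) :
    Integrable (fun x => roundReward i (a, x)) (feedback P a) := by
  refine integrable_finsetSum _ fun u _ => ?_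
  by_cases h : a u = i
  · simpa [h] using integrable_feedback_eval P a u
  · simp [h]

lemma integral_roundReward_feedback (hQ : ∀ u, Q u i = 0) (a : Fin M → Fin N) :
    ∫ x, roundReward i (a, x) ∂feedback Q a = 0 := by
  simp only [roundReward]
  rw [integral_finsetSum]
  · refine Finset.sum_eq_zero fun u _ => ?_
    by_cases h : a u = i
    · simp [h, integral_feedback_eval, hQ]
    · simp [h]
  · intro u _
    by_cases h : a u = i
    · simpa [h] using integrable_feedback_eval Q a u
    · simp [h]

/-- There are finitely many joint recommendations, so summing over all of them bounds the first
moment uniformly in the history. This gives integrability against the composed measure. -/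
lemma exists_lintegral_roundReward_le (π : Policy M N) (P : Fin M → Fin N → ℝ) (i : Fin N) :
    ∃ C : ℝ≥0∞, C ≠ ∞ ∧ ∀ t (h : History M N t),
      ∫⁻ r, ‖roundReward i r‖ₑ ∂roundKernel π P t h ≤ C := by
  refine ⟨∑ a, ∫⁻ x, ‖roundReward i (a, x)‖ₑ ∂feedback P a, ?_, fun t h => ?_⟩
  · exact (ENNReal.sum_lt_top.2 fun a _ =>
      (integrable_roundReward_feedback i P a).hasFiniteIntegral).ne
  · rw [lintegral_roundKernel π P t h (measurable_roundReward i).enorm]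
    calc _ ≤ ∫⁻ _, (∑ a, ∫⁻ x, ‖roundReward i (a, x)‖ₑ ∂feedback P a) ∂π.choose t h :=
          lintegral_mono fun a => Finset.single_le_sum
            (f := fun a => ∫⁻ x, ‖roundReward i (a, x)‖ₑ ∂feedback P a) (fun _ _ => zero_le)
            (Finset.mem_univ a)
      _ = _ := by simp

lemma integrable_roundReward (π : Policy M N) (P : Fin M → Fin N → ℝ) (i : Fin N) (t : ℕ)
    (h : History M N t) : Integrable (roundReward i) (roundKernel π P t h) := by
  obtain ⟨C, hC, hle⟩ := exists_lintegral_roundReward_le π P i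
  exact ⟨(measurable_roundReward i).aestronglyMeasurable, (hle t h).trans_lt hC.lt_top⟩

lemma integral_roundReward (π : Policy M N) (hQ : ∀ u, Q u i = 0) (t : ℕ) (h : History M N t) :
    ∫ r, roundReward i r ∂roundKernel π Q t h = 0 := by
  have hi := integrable_roundReward π Q i t h
  rw [roundKernel] at hi ⊢
  rw [ProbabilityTheory.integral_compProd hi]
  simp [integral_roundReward_feedback hQ]

/-- If the mean reward of item `i` is `0`, then so is the expected total reward from it. -/
lemma integral_itemReward (π : Policy M N) (hQ : ∀ u, Q u i = 0) (t : ℕ) :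
    Integrable (itemReward i) (historyLaw π Q t) ∧ ∫ h, itemReward i h ∂historyLaw π Q t = 0 := by
  induction t with
  | zero => simp [itemReward]
  | succ t ih =>
    obtain ⟨C, hC, hle⟩ := exists_lintegral_roundReward_le π Q i
    have hm : Measurable (itemReward (M := M) i (t := t + 1)) :=
      Finset.measurable_fun_sum _ fun s _ =>
        (measurable_roundReward i).comp (measurable_pi_apply s)
    have heq : ∀ x : History M N t × Round M N,
        itemReward i (Fin.snoc x.1 x.2 : History M N (t + 1)) =
          itemReward i x.1 + roundReward i x.2 := fun x => by
      simp only [itemReward, Fin.sum_univ_castSucc, Fin.snoc_castSucc, Fin.snoc_last]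
    have h1 : Integrable (fun x : History M N t × Round M N => itemReward i x.1)
        (historyLaw π Q t ⊗ₘ roundKernel π Q t) := by
      have h := ih.1
      rw [← Measure.fst_compProd (historyLaw π Q t) (roundKernel π Q t), Measure.fst] at h
      exact h.comp_measurable measurable_fst
    have h2 : Integrable (fun x : History M N t × Round M N => roundReward i x.2)
        (historyLaw π Q t ⊗ₘ roundKernel π Q t) := by
      refine ⟨((measurable_roundReward i).comp measurable_snd).aestronglyMeasurable, ?_⟩
      rw [HasFiniteIntegral, Measure.lintegral_compProd
        (f := fun x : History M N t × Round M N => ‖roundReward i x.2‖ₑ)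
        (((measurable_roundReward i).comp measurable_snd).enorm)]
      refine (lintegral_mono fun h => hle t h).trans_lt ?_
      simpa using hC.lt_top
    constructor
    · rw [historyLaw, integrable_map_measure hm.aestronglyMeasurable measurable_snoc.aemeasurable]
      exact (h1.add h2).congr (Filter.Eventually.of_forall fun x => (heq x).symm)
    · rw [historyLaw, integral_map measurable_snoc.aemeasurable hm.aestronglyMeasurable]
      simp_rw [heq]
      rw [integral_add h1 h2, Measure.integral_compProd h1, Measure.integral_compProd h2]
      simp [integral_roundReward π hQ, ih.2]

/-! ### Effect of a shift on the expected number of pulls. -/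

/-- Substitute for Pinsker's inequality: with `x` the likelihood ratio, the last bracket integrates
to the KL divergence. The bound is affine in it, so it can be averaged over items without Jensen. It
follows from `log y ≤ y - 1` at `y = x / (1 + a)` and `y = 1 + a`. -/
lemma sub_one_le_of_pos {a x : ℝ} (ha : 0 < a) (hx : 0 < x) :
    x - 1 ≤ a + (1 + 1 / a) * (x - 1 - Real.log x) := by
  have h := Real.log_le_sub_one_of_pos (show 0 < x / (1 + a) by positivity)
  rw [Real.log_div hx.ne' (by positivity)] at h
  have h2 := Real.log_le_sub_one_of_pos (show 0 < 1 + a by positivity)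
  have h3 : (1 + 1 / a) * Real.log x ≤ (1 + 1 / a) * (x / (1 + a) - 1 + a) :=
    mul_le_mul_of_nonneg_left (by linarith) (by positivity)
  have h4 : (1 + 1 / a) * (x / (1 + a) - 1 + a) = x / a + a - 1 / a := by field_simp; ring
  have h5 : (1 + 1 / a) * (x - 1 - Real.log x) =
    x - 1 + x / a - 1 / a - (1 + 1 / a) * Real.log x := by ring
  linarith

lemma pulls_nonneg (i : Fin N) {t : ℕ} (h : History M N t) : 0 ≤ pulls i h :=
  Finset.sum_nonneg fun _ _ => Finset.sum_nonneg fun _ _ => by split_ifs <;> norm_num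

lemma pulls_le_mul (i : Fin N) {t : ℕ} (h : History M N t) : pulls i h ≤ t * M := by
  calc pulls i h ≤ ∑ _s : Fin t, ∑ _u : Fin M, (1 : ℝ) :=
        Finset.sum_le_sum fun _ _ => Finset.sum_le_sum fun _ _ => by split_ifs <;> norm_num
    _ = t * M := by simp

lemma integrable_pulls (π : Policy M N) (P : Fin M → Fin N → ℝ) (i : Fin N) (t : ℕ) :
    Integrable (pulls i) (historyLaw π P t) :=
  Integrable.of_bound (measurable_pulls i t).aestronglyMeasurable (t * M)
    (Filter.Eventually.of_forall fun h => by
      rw [Real.norm_of_nonneg (pulls_nonneg i h)]; exact pulls_le_mul i h)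

/-- Moving the mean reward of item `i` from `0` to `Δ` increases the expected number of its
recommendations by a controlled amount. -/
lemma IsShift.integral_pulls_le (hS : IsShift Q P i Δ) (π : Policy M N) (t : ℕ) {K a : ℝ}
    (hK : ∀ᵐ h ∂historyLaw π Q t, pulls i h ≤ K) (ha : 0 < a) :
    ∫ h, pulls i h ∂historyLaw π P t ≤ ∫ h, pulls i h ∂historyLaw π Q t +
      K * (a + (1 + 1 / a) * (Δ ^ 2 / 2 * ∫ h, pulls i h ∂historyLaw π Q t)) := by
  set μ := historyLaw π Q t
  set n : History M N t → ℝ := pulls i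
  set L : History M N t → ℝ := fun h => Real.exp (logLikelihood i Δ h)
  have hn : Integrable n μ := integrable_pulls π Q i t
  have hLm : Measurable L := (measurable_logLikelihood i Δ t).exp
  have hL1 : ∫⁻ h, ENNReal.ofReal (L h) ∂μ = 1 := by
    have := hS.lintegral_historyLaw π t (f := fun _ => 1) measurable_const
    simpa using this.symm
  have hL : Integrable L μ := by
    refine ⟨hLm.aestronglyMeasurable, ?_⟩
    rw [hasFiniteIntegral_iff_ofReal (Filter.Eventually.of_forall fun h => (Real.exp_pos _).le), hL1]
    exact ENNReal.one_lt_top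
  have hLint : ∫ h, L h ∂μ = 1 := by
    rw [integral_eq_lintegral_of_nonneg_ae (Filter.Eventually.of_forall fun h => (Real.exp_pos _).le)
      hLm.aestronglyMeasurable, hL1, ENNReal.toReal_one]
  have hnL : Integrable (fun h => n h * L h) μ :=
    hL.bdd_mul (c := t * M) (measurable_pulls i t).aestronglyMeasurable
      (Filter.Eventually.of_forall fun h => by
        rw [Real.norm_of_nonneg (pulls_nonneg i h)]; exact pulls_le_mul i h)
  have hP : ∫ h, n h ∂historyLaw π P t = ∫ h, n h * L h ∂μ := by
    rw [integral_eq_lintegral_of_nonneg_ae (Filter.Eventually.of_forall (pulls_nonneg i))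
      (measurable_pulls i t).aestronglyMeasurable,
      integral_eq_lintegral_of_nonneg_ae (Filter.Eventually.of_forall fun h =>
        mul_nonneg (pulls_nonneg i h) (Real.exp_pos _).le) hnL.aestronglyMeasurable,
      hS.lintegral_historyLaw π t (measurable_pulls i t).ennreal_ofReal]
    congr 1
    exact lintegral_congr fun h => (ENNReal.ofReal_mul (pulls_nonneg i h)).symm
  obtain ⟨hZ, hZ0⟩ := integral_itemReward π hS.base t
  have hlog : Integrable (logLikelihood i Δ) μ := by
    have : logLikelihood i Δ = fun h : History M N t =>
      Δ * itemReward i h - Δ ^ 2 / 2 * pulls i h := funext fun h => logLikelihood_eq i Δ h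
    rw [this]
    exact (hZ.const_mul Δ).sub (hn.const_mul _)
  -- Minus the KL divergence of `Q` from `P`; the reward term has mean zero under `Q`.
  have hlogint : ∫ h, logLikelihood i Δ h ∂μ = -(Δ ^ 2 / 2 * ∫ h, n h ∂μ) := by
    simp_rw [logLikelihood_eq]
    rw [integral_sub (hZ.const_mul Δ) (hn.const_mul _), integral_const_mul, integral_const_mul, hZ0]
    ring
  have hD : Integrable (fun h => L h - 1 - logLikelihood i Δ h) μ :=
    (hL.sub (integrable_const 1)).sub hlog
  have hR : Integrable (fun h => a + (1 + 1 / a) * (L h - 1 - logLikelihood i Δ h)) μ :=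
    (integrable_const a).add (hD.const_mul _)
  have hRint : ∫ h, (a + (1 + 1 / a) * (L h - 1 - logLikelihood i Δ h)) ∂μ =
      a + (1 + 1 / a) * (Δ ^ 2 / 2 * ∫ h, n h ∂μ) := by
    rw [integral_add (integrable_const a) (hD.const_mul _),
      integral_const_mul, integral_sub (f := fun h => L h - 1) (hL.sub (integrable_const 1)) hlog,
      integral_sub hL (integrable_const 1), hLint, hlogint]
    simp
  have hmono : ∫ h, (n h * L h - n h) ∂μ ≤
      ∫ h, K * (a + (1 + 1 / a) * (L h - 1 - logLikelihood i Δ h)) ∂μ := by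
    refine integral_mono_ae (hnL.sub hn) (hR.const_mul K) ?_
    filter_upwards [hK] with h hh
    have h1 := sub_one_le_of_pos ha (Real.exp_pos (logLikelihood i Δ h))
    rw [Real.log_exp] at h1
    -- Nonnegativity of the bracket allows `n h` to be replaced by its bound `K`.
    have h0 : 0 ≤ a + (1 + 1 / a) * (L h - 1 - logLikelihood i Δ h) := by
      have := Real.add_one_le_exp (logLikelihood i Δ h)
      have : 0 ≤ L h - 1 - logLikelihood i Δ h := by simp only [L]; linarith
      positivity
    calc n h * L h - n h = n h * (L h - 1) := by ring
      _ ≤ n h * (a + (1 + 1 / a) * (L h - 1 - logLikelihood i Δ h)) :=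
          mul_le_mul_of_nonneg_left h1 (pulls_nonneg i h)
      _ ≤ _ := mul_le_mul_of_nonneg_right hh h0
  rw [integral_sub hnL hn, integral_const_mul, hRint] at hmono
  rw [hP]
  linarith

/-! ### Hard instances and their regret. -/

/-- The reward matrix giving mean reward `Δ` to the items of `G` and `0` to the others. -/
def goodItems (M : ℕ) (G : Finset (Fin N)) (Δ : ℝ) : Fin M → Fin N → ℝ :=
  fun _ j => if j ∈ G then Δ else 0

lemma isShift_goodItems {G : Finset (Fin N)} {i : Fin N} (hi : i ∉ G) (Δ : ℝ) :
    IsShift (goodItems M G Δ) (goodItems M (insert i G) Δ) i Δ where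
  base _ := by simp [goodItems, hi]
  shifted _ := by simp [goodItems]
  agree _ j hj := by simp [goodItems, hj]

lemma sum_pulls {t : ℕ} (h : History M N t) : ∑ i, pulls i h = t * M := by
  simp only [pulls, roundPulls]
  rw [Finset.sum_comm]
  simp_rw [Finset.sum_comm (s := (Finset.univ : Finset (Fin N)))]
  simp

lemma pulls_eq_sum_card {t : ℕ} (i : Fin N) (h : History M N t) :
    pulls i h = ∑ u : Fin M, ((Finset.univ.filter fun s : Fin t => (h s).1 u = i).card : ℝ) := by
  simp only [pulls, roundPulls]
  rw [Finset.sum_comm]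
  simp

lemma Policy.RespectsBlocking.pulls_le {π : Policy M N} {T B : ℕ} (hπ : π.RespectsBlocking T B)
    (P : Fin M → Fin N → ℝ) (i : Fin N) :
    ∀ᵐ h ∂historyLaw π P T, pulls i h ≤ M * B := by
  filter_upwards [hπ P] with h hh
  rw [pulls_eq_sum_card]
  calc _ ≤ ∑ _u : Fin M, (B : ℝ) := Finset.sum_le_sum fun u _ => by exact_mod_cast hh u i
    _ = M * B := by simp

/-- Either the first `S` sorted values all equal `Δ`, or a zero occurs among them; then everything
after it vanishes and the partial sum is the full sum. -/
lemma mul_card_le_sum_sortDesc {G : Finset (Fin N)} {Δ : ℝ} (hΔ : 0 ≤ Δ) {S : ℕ} (hG : G.card ≤ S)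
    (hS : S ≤ N) (u : Fin M) :
    Δ * G.card ≤ ∑ s : Fin N with s.val < S,
      goodItems M G Δ u (sortDesc (goodItems M G Δ u) s) := by
  set p := goodItems M G Δ u with hp
  have hanti : ∀ s s', s ≤ s' → p (sortDesc p s') ≤ p (sortDesc p s) := fun s s' hss => by
    have := Tuple.monotone_sort (fun i => -p i) hss
    simpa [sortDesc] using this
  have hp0 : ∀ j, 0 ≤ p j := fun j => by
    simp only [hp, goodItems]; split_ifs <;> simp [hΔ]
  have hall : ∑ s, p (sortDesc p s) = Δ * G.card := by
    rw [Equiv.sum_comp (sortDesc p) p]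
    simp [hp, goodItems, mul_comm]
  by_cases hc : ∀ s : Fin N, s.val < S → p (sortDesc p s) = Δ
  · rw [Finset.sum_congr rfl fun s hs => hc s (Finset.mem_filter.1 hs).2, Finset.sum_const]
    have hcard : (Finset.univ.filter fun s : Fin N => s.val < S).card = S := by
      rw [Fin.card_filter_val_lt, min_eq_right hS]
    rw [hcard, nsmul_eq_mul, mul_comm]
    gcongr
  · push Not at hc
    obtain ⟨s₀, hs₀, hne⟩ := hc
    have h0 : p (sortDesc p s₀) = 0 := by
      by_contra h
      apply hne
      simp only [hp, goodItems] at h ⊢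
      split_ifs at h ⊢ <;> simp_all
    rw [← hall, Finset.sum_filter]
    refine (Finset.sum_congr rfl fun s _ => ?_).le
    split_ifs with h
    · rfl
    · refine le_antisymm ?_ (hp0 _)
      rw [← h0]
      exact hanti _ _ (Fin.le_def.2 (by omega))

lemma goodItems_regret_ge (π : Policy M N) {G : Finset (Fin N)} {Δ : ℝ} (hΔ : 0 ≤ Δ) {T B : ℕ}
    (hM : 1 ≤ M) (hG : G.card ≤ T / B) (hN : T / B ≤ N) :
    Δ * B * G.card - Δ / M * ∑ i ∈ G, ∫ h, pulls i h ∂historyLaw π (goodItems M G Δ) T ≤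
      regret π (goodItems M G Δ) T B := by
  have hM0 : (M : ℝ) ≠ 0 := by positivity
  have hsum : ∀ h : History M N T, ∑ t : Fin T, ∑ u : Fin M, goodItems M G Δ u ((h t).1 u) / M =
      Δ / M * ∑ i ∈ G, pulls i h := fun h => by
    simp only [pulls, roundPulls]
    rw [Finset.sum_comm (s := G), Finset.mul_sum]
    refine Finset.sum_congr rfl fun t _ => ?_
    rw [Finset.sum_comm (s := G), Finset.mul_sum]
    refine Finset.sum_congr rfl fun u _ => ?_
    rw [Finset.sum_ite_eq]
    simp only [goodItems]
    split_ifs <;> simp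
  rw [regret]
  simp_rw [hsum]
  rw [integral_const_mul, integral_finsetSum _ fun i _ => integrable_pulls π _ i T]
  refine sub_le_sub_right ?_ _
  calc Δ * B * G.card = ∑ _u : Fin M, B / M * (Δ * G.card) := by
        rw [Finset.sum_const, Finset.card_univ, Fintype.card_fin, nsmul_eq_mul]
        field_simp
    _ ≤ ∑ u : Fin M, B / M * ∑ s : Fin N with s.val < T / B,
          goodItems M G Δ u (sortDesc (goodItems M G Δ u) s) :=
        Finset.sum_le_sum fun u _ => mul_le_mul_of_nonneg_left
          (mul_card_le_sum_sortDesc hΔ hG hN u) (by positivity)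
    _ = _ := by
        simp_rw [Finset.mul_sum]
        refine Finset.sum_congr rfl fun u _ => Finset.sum_congr rfl fun s _ => ?_
        ring

/-! ### Averaging over the set of good items. -/

lemma sum_powersetCard_succ_sum_mem {α : Type*} [Fintype α] [DecidableEq α] (k : ℕ)
    (f : Finset α → α → ℝ) :
    ∑ G ∈ Finset.powersetCard (k + 1) Finset.univ, ∑ i ∈ G, f G i =
      ∑ G ∈ Finset.powersetCard k Finset.univ, ∑ i ∈ Gᶜ, f (insert i G) i := by
  rw [Finset.sum_sigma', Finset.sum_sigma']
  refine Finset.sum_bij' (fun x _ => ⟨x.1.erase x.2, x.2⟩) (fun x _ => ⟨insert x.2 x.1, x.2⟩)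
    ?_ ?_ ?_ ?_ ?_
  · rintro ⟨G, i⟩ h
    simp only [Finset.mem_sigma, Finset.mem_powersetCard_univ] at h
    simp [Finset.card_erase_of_mem h.2, h.1]
  · rintro ⟨G, i⟩ h
    simp only [Finset.mem_sigma, Finset.mem_powersetCard_univ, Finset.mem_compl] at h
    simp [Finset.card_insert_of_notMem h.2, h.1]
  · rintro ⟨G, i⟩ h
    simp only [Finset.mem_sigma] at h
    simp [Finset.insert_erase h.2]
  · rintro ⟨G, i⟩ h
    simp only [Finset.mem_sigma, Finset.mem_compl] at h
    simp [Finset.erase_insert h.2]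
  · rintro ⟨G, i⟩ h
    simp only [Finset.mem_sigma] at h
    simp [Finset.insert_erase h.2]

/-- Sum `e G i` over all `G` of size `k + 1` and `i ∈ G`, then reindex by `G.erase i`. The ratio of
the two binomial coefficients is `(N - k) / (k + 1)`. -/
lemma le_of_forall_insert_le {k : ℕ} (hk : k ≤ N) {e : Finset (Fin N) → Fin N → ℝ}
    {A W p q : ℝ} (hp : 0 ≤ p) (hA : ∀ G, G.card = k + 1 → A ≤ ∑ i ∈ G, e G i)
    (hW : ∀ G, G.card = k → ∑ i ∈ Gᶜ, e G i ≤ W)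
    (he : ∀ G, G.card = k → ∀ i ∉ G, e (insert i G) i ≤ p * e G i + q) :
    (N - k) * A ≤ (k + 1) * (p * W + (N - k) * q) := by
  have h1 : (N.choose (k + 1) : ℝ) * A ≤
      ∑ G ∈ Finset.powersetCard (k + 1) (Finset.univ : Finset (Fin N)), ∑ i ∈ G, e G i := by
    have := Finset.card_nsmul_le_sum (Finset.powersetCard (k + 1) (Finset.univ : Finset (Fin N)))
      (fun G => ∑ i ∈ G, e G i) A fun G hG => hA G (Finset.mem_powersetCard_univ.1 hG)
    simpa using this
  have h2 : ∑ G ∈ Finset.powersetCard k (Finset.univ : Finset (Fin N)),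
      ∑ i ∈ Gᶜ, e (insert i G) i ≤ (N.choose k : ℝ) * (p * W + (N - k) * q) := by
    have := Finset.sum_le_card_nsmul (Finset.powersetCard k (Finset.univ : Finset (Fin N)))
      (fun G => ∑ i ∈ Gᶜ, e (insert i G) i) (p * W + (N - k) * q) fun G hG => by
        have hG := Finset.mem_powersetCard_univ.1 hG
        calc ∑ i ∈ Gᶜ, e (insert i G) i ≤ ∑ i ∈ Gᶜ, (p * e G i + q) :=
              Finset.sum_le_sum fun i hi => he G hG i (Finset.mem_compl.1 hi)
          _ = p * ∑ i ∈ Gᶜ, e G i + (N - k) * q := by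
              rw [Finset.sum_add_distrib, ← Finset.mul_sum, Finset.sum_const, Finset.card_compl,
                hG, Fintype.card_fin, nsmul_eq_mul, Nat.cast_sub hk]
          _ ≤ _ := by gcongr; exact hW G hG
    rwa [Finset.card_powersetCard, Finset.card_univ, Fintype.card_fin, nsmul_eq_mul] at this
  rw [sum_powersetCard_succ_sum_mem] at h1
  have hc : (N.choose (k + 1) : ℝ) * (k + 1) = N.choose k * (N - k) := by
    rw [← Nat.cast_sub hk]
    exact_mod_cast Nat.choose_succ_right_eq N k
  have hpos : (0 : ℝ) < N.choose k := by exact_mod_cast Nat.choose_pos hk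
  refine le_of_mul_le_mul_left ?_ hpos
  calc (N.choose k : ℝ) * ((N - k) * A) = (k + 1) * (N.choose (k + 1) * A) := by
        rw [← mul_assoc, ← hc]; ring
    _ ≤ (k + 1) * (N.choose k * (p * W + (N - k) * q)) := by
        exact mul_le_mul_of_nonneg_left (h1.trans h2) (by positivity)
    _ = _ := by ring

/-- If the gap `Δ` is too small to be detected, some set of good items causes regret of order
`Δ * T`. -/
lemma exists_goodItems_regret_ge {S B : ℕ} (hM : 1 ≤ M) (hS : 1 ≤ S) (hB : 1 ≤ B) {ε Δ : ℝ}
    (hε : 0 < ε) (hN : (1 + ε) * S ≤ N) (hΔ : 0 < Δ)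
    (hΔD : 272 * (M * (S * B)) * Δ ^ 2 ≤ (N : ℝ) - S + 1) (π : Policy M N)
    (hπ : π.RespectsBlocking (S * B) B) :
    ∃ G : Finset (Fin N), min ε 1 / 8 * (Δ * (S * B)) ≤
      regret π (goodItems M G Δ) (S * B) B := by
  by_contra! hcon
  set ρ := min ε 1 / 8 with hρ
  have hρ0 : 0 < ρ := by positivity
  have hρε : 8 * ρ ≤ ε := by rw [hρ]; linarith [min_le_left ε 1]
  have hρ1 : 8 * ρ ≤ 1 := by rw [hρ]; linarith [min_le_right ε 1]
  obtain ⟨k, rfl⟩ : ∃ k, S = k + 1 := ⟨S - 1, by omega⟩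
  have hdiv : (k + 1) * B / B = k + 1 := Nat.mul_div_cancel _ (by omega)
  have hk : k + 1 < N := by
    have : ((k + 1 : ℕ) : ℝ) < N := by
      refine lt_of_lt_of_le ?_ hN
      have : (0 : ℝ) < (k + 1 : ℕ) := by positivity
      nlinarith
    exact_mod_cast this
  have hMp : (0 : ℝ) < M := by exact_mod_cast hM
  have hBp : (0 : ℝ) < B := by exact_mod_cast hB
  have hk0 : (0 : ℝ) ≤ k := k.cast_nonneg
  have hk2 : (k : ℝ) + 2 ≤ N := by exact_mod_cast hk
  push_cast at hN hΔD hcon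
  have hM0 : (M : ℝ) ≠ 0 := hMp.ne'
  -- `A` is the least number of good pulls when `|G| = k + 1`; `W` is the largest number of bad
  -- pulls when `|G| = k`, where the `k` good items can absorb only `MBk` pulls.
  have key := le_of_forall_insert_le (N := N) (k := k) (by omega)
    (e := fun G i => ∫ h, pulls i h ∂historyLaw π (goodItems M G Δ) ((k + 1) * B))
    (A := M * ((k + 1) * B) * (1 - ρ)) (W := M * B * (1 + ρ * (k + 1)))
    (p := 1 + M * B * (17 * (Δ ^ 2 / 2))) (q := M * B * (1 / 16)) (by positivity)
    (fun G hG => by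
      have h := (goodItems_regret_ge π hΔ.le hM (by rw [hdiv, hG]) (by omega)).trans
        (hcon G).le
      rw [hG] at h
      push_cast at h
      have h' : Δ / M * (M * ((k + 1) * B) * (1 - ρ)) ≤
          Δ / M * ∑ i ∈ G, ∫ h, pulls i h ∂historyLaw π (goodItems M G Δ) ((k + 1) * B) := by
        have : Δ / M * (M * ((k + 1) * B) * (1 - ρ)) =
          Δ * B * (k + 1) - ρ * (Δ * ((k + 1) * B)) := by field_simp
        rw [this]; linarith
      exact le_of_mul_le_mul_left h' (by positivity))
    (fun G hG => by
      have h := (goodItems_regret_ge π hΔ.le hM (by rw [hdiv, hG]; omega) (by omega)).trans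
        (hcon G).le
      have htot : ∑ i, ∫ h, pulls i h ∂historyLaw π (goodItems M G Δ) ((k + 1) * B) =
          (k + 1) * B * M := by
        rw [← integral_finsetSum _ fun i _ => integrable_pulls π _ i _]
        simp [sum_pulls]
      rw [← Finset.sum_add_sum_compl G] at htot
      rw [hG, eq_sub_of_add_eq htot] at h
      have h' : Δ / M *
          ∑ i ∈ Gᶜ, ∫ h, pulls i h ∂historyLaw π (goodItems M G Δ) ((k + 1) * B) ≤
          Δ / M * (M * B * (1 + ρ * (k + 1))) := by
        have h1 : Δ / M * (M * B * (1 + ρ * (k + 1))) =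
          Δ * B + ρ * (Δ * ((k + 1) * B)) := by field_simp
        have h2 : Δ / M * ((k + 1) * B * M) = Δ * ((k + 1) * B) := by field_simp
        rw [mul_sub, h2] at h
        rw [h1]; linarith
      exact le_of_mul_le_mul_left h' (by positivity))
    -- The choice `a = 1/16` makes `1 + 1/a = 17`, the factor in `p`, and `q = MB/16`.
    (fun G _ i hi => by
      have h := (isShift_goodItems (M := M) hi Δ).integral_pulls_le π ((k + 1) * B)
        (hπ.pulls_le _ i) (show (0 : ℝ) < 1 / 16 by norm_num)
      norm_num at h ⊢
      linarith)
  set D : ℝ := (N : ℝ) - k with hD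
  set x : ℝ := M * B * (17 * (Δ ^ 2 / 2)) with hx
  -- Here `272 = 32 · 17/2`.
  have hx1 : x * (k + 1) ≤ D / 32 := by
    rw [hx, hD]; linarith
  have hx0 : 0 ≤ x := by positivity
  have h1 : D * (1 - ρ) ≤ (1 + x) * (1 + ρ * (k + 1)) + D * (1 / 16) := by
    have hpos : (0 : ℝ) < M * B * (k + 1) := by positivity
    refine le_of_mul_le_mul_left ?_ hpos
    linarith
  have h2 : x * (1 + ρ * (k + 1)) ≤ x * (2 * (k + 1)) :=
    mul_le_mul_of_nonneg_left (by nlinarith) hx0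
  have h3 : 8 * ρ * (k + 1) ≤ ε * (k + 1) := by gcongr
  have h4 : D * ρ ≤ D * (1 / 8) := by
    gcongr
    · linarith
    · linarith
  -- Since `ε(k+1) ≤ D - 1`, what remains is `13D/16 ≤ 1 + (D-1)/8 + D/16`, which fails because `D ≥
  -- 2`.
  linarith

end

end BlockedBandits


/-! ### Comparison of rates and conclusion. -/

/-- The first term uses `B ≤ T`; the second uses `log⁺ x ≤ x` and `B ≥ 1`. -/
lemma max_sqrt_le_sqrt_mul_div {M N T B : ℝ} (hM : 0 < M) (hN : 0 ≤ N) (hT : 0 < T) (hB : 1 ≤ B)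
    (hBT : B ≤ T) :
    max (Real.sqrt (N * B / M)) (T * Real.sqrt (Real.posLog (N / T)) / (B * Real.sqrt M)) ≤
      Real.sqrt (N * T / M) := by
  refine max_le (Real.sqrt_le_sqrt (by gcongr)) ?_
  have hlog : Real.posLog (N / T) ≤ N / T := by
    refine max_le (by positivity) ?_
    exact Real.log_le_self (by positivity)
  calc T * Real.sqrt (Real.posLog (N / T)) / (B * Real.sqrt M)
      ≤ T * Real.sqrt (N / T) / (1 * Real.sqrt M) := by gcongr
    _ = Real.sqrt (N * T / M) := by
      rw [one_mul, show N * T / M = T ^ 2 * (N / T) / M by field_simp,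
        Real.sqrt_div (by positivity) M, Real.sqrt_mul (by positivity) (N / T),
        Real.sqrt_sq hT.le]

theorem theorem2 (ε : ℝ) (hε : 0 < ε) :
    ∃ c : ℝ, 0 < c ∧
      ∀ M N T B : ℕ, 1 ≤ M → 1 ≤ T → 1 ≤ B → B ∣ T → (1 + ε) * ((T : ℝ) / B) ≤ N →
        ∀ π : BlockedBandits.Policy M N, π.RespectsBlocking T B →
          ∃ P : Fin M → Fin N → ℝ,
            (∀ u i, P u i ∈ Set.Icc (0 : ℝ) 1) ∧ BlockedBandits.HasClusters P 1 ∧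
              c * min (T : ℝ)
                  (max (Real.sqrt ((N : ℝ) * B / M))
                    ((T : ℝ) * Real.sqrt (Real.posLog ((N : ℝ) / T)) / (B * Real.sqrt M)))
                ≤ BlockedBandits.regret π P T B := by
  -- With `D ≥ N · ε/(1+ε)`, this factor gives `ΔT ≥ s √(NT/M)` whenever `Δ < 1`.
  set s : ℝ := Real.sqrt (ε / (272 * (1 + ε))) with hs
  have hs0 : 0 < s := by positivity
  have hs1 : s ≤ 1 := by
    rw [hs, Real.sqrt_le_one, div_le_one (by positivity)]
    linarith
  refine ⟨min ε 1 / 8 * s, by positivity, ?_⟩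
  rintro M N T B hM hT hB ⟨S, rfl⟩ hN π hπ
  have hMp : (0 : ℝ) < M := by exact_mod_cast hM
  have hBp : (1 : ℝ) ≤ B := by exact_mod_cast hB
  have hS : 1 ≤ S := Nat.one_le_iff_ne_zero.2 (by rintro rfl; simp at hT)
  have hSp : (1 : ℝ) ≤ S := by exact_mod_cast hS
  rw [mul_comm B S] at *
  push_cast at hN ⊢
  rw [mul_div_cancel_right₀ _ (by positivity)] at hN
  set D : ℝ := (N : ℝ) - S + 1 with hD
  have hDN : N * (ε / (1 + ε)) ≤ D := by
    have : (S : ℝ) ≤ N / (1 + ε) := by rw [le_div_iff₀ (by positivity)]; linarith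
    have h2 : N * (ε / (1 + ε)) = N - N / (1 + ε) := by field_simp; ring
    rw [h2, hD]; linarith
  have hN0 : (0 : ℝ) < N := lt_of_lt_of_le (by positivity) hN
  have hD0 : 0 < D := lt_of_lt_of_le (by positivity) hDN
  -- The largest gap allowed by the detection threshold, capped at `1` to keep rewards in `[0,1]`.
  set Δ : ℝ := min 1 (Real.sqrt (D / (272 * (M * (S * B))))) with hΔ
  have hΔ0 : 0 < Δ := by positivity
  have hΔD : 272 * (M * (S * B)) * Δ ^ 2 ≤ D := by
    have : Δ ^ 2 ≤ D / (272 * (M * (S * B))) := by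
      rw [← Real.sq_sqrt (show 0 ≤ D / (272 * (M * (S * B))) by positivity)]
      exact pow_le_pow_left₀ hΔ0.le (min_le_right _ _) 2
    rw [le_div_iff₀ (by positivity)] at this
    linarith
  obtain ⟨G, hG⟩ := BlockedBandits.exists_goodItems_regret_ge hM hS hB hε hN hΔ0 hΔD π hπ
  refine ⟨BlockedBandits.goodItems M G Δ, fun u i => ?_, ⟨fun _ => 0, ?_, fun _ _ _ => rfl⟩,
    le_trans ?_ hG⟩
  · simp only [BlockedBandits.goodItems]
    split_ifs
    · exact ⟨hΔ0.le, min_le_left _ _⟩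
    · simp
  · exact fun b => ⟨⟨0, hM⟩, Subsingleton.elim _ _⟩
  · rw [mul_assoc]
    refine mul_le_mul_of_nonneg_left ?_ (by positivity)
    have hX := max_sqrt_le_sqrt_mul_div hMp hN0.le (show (0 : ℝ) < S * B by positivity) hBp
      (by nlinarith)
    rcases le_total 1 (Real.sqrt (D / (272 * (M * (S * B))))) with h | h
    · rw [hΔ, min_eq_left h]
      exact mul_le_mul hs1 (min_le_left _ _) (by positivity) zero_le_one
    · rw [hΔ, min_eq_right h]
      calc _ ≤ s * Real.sqrt (N * (S * B) / M) := by
            gcongr; exact (min_le_right _ _).trans hX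
        _ = Real.sqrt (N * (ε / (1 + ε)) / (272 * (M * (S * B))) * (S * B) ^ 2) := by
            rw [hs, ← Real.sqrt_mul (by positivity)]
            congr 1
            field_simp
        _ ≤ Real.sqrt (D / (272 * (M * (S * B))) * (S * B) ^ 2) := by gcongr
        _ = _ := by rw [Real.sqrt_mul (by positivity), Real.sqrt_sq (by positivity)]
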